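/- Let $P$ be any discrete probability distribution on a space $\mathbb{S}$ and let $\mathbf{X}_n=(X_1,\dots,X_n)$ be i.i.d. with law $P$. For $s\in\mathbb{S}$ write $p_s=P(\{s\})$ and $Y_{n,s}=\sum_{i=1}^n I(X_i=s)$. For an integer $r\ge 1$ let $M_{n,r}=\#\{s: Y_{n,s}=r\}$, let $C_{n,r}=\#\{s: Y_{n,s}\ge r\}$, and let $$\theta_r(P;\mathbf{X}_n)=\sum_{s} p_s^{\,r}\, I(Y_{n,s}=0),\qquad \hat\theta_r(\mathbf{X}_n)=\frac{M_{n,r}}{\binom{n}{r}}$$ be the $r$-order missing mass and its Good--Turing type estimator. For $x>0$ define $$\mathfrak{L}_{n,r}(x)=\hat\theta_r(\mathbf{X}_n)-\frac{a_1(n,r)}{n^r}\sqrt{C_{n,r}x}-\frac{a_2(n,r)}{n^r}x-\frac{a_3(n,r)}{n^{1+r}}C_{n,r},$$ $$\mathfrak{U}_{n,r}(x)=\hat\theta_r(\mathbf{X}_n)+\frac{b_1(n,r)}{n^r}\sqrt{C_{n,r}x}+\frac{b_2(n,r)}{n^r}x+\frac{[x+\log n]^r}{n^r}\,\frac{2^{r+1}x}{3},$$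 where $$a_1(n,r)=b_1(n,r)=n^r\Bigg[\sqrt{\frac{2}{\binom{n}{2r}}}+\frac{2\sqrt2}{\binom{n}{r}}\Bigg],\qquad a_2(n,r)=n^r\Bigg[\frac{4}{\sqrt{\binom{n}{2r}}}+\frac{8+2/3}{\binom{n}{r}}+\frac{16r}{\binom{n}{r+1}}\Bigg],$$ $$a_3(n,r)=n^{1+r}\frac{2r}{\binom{n}{r+1}},\qquad b_2(n,r)=n^r\Bigg[\frac{4}{\sqrt{\binom{n}{2r}}}+\frac{8+2/3}{\binom{n}{r}}\Bigg].$$ Then for every discrete $P$, every integer $r\ge1$, every integer $n>2r$ and every real $x>0$: with probability at least $1-6e^{-x}$, $$\theta_r(P;\mathbf{X}_n)\ \ge\ \max\big(0,\ \mathfrak{L}_{n,r}(x)\big),$$ and with probability at least $1-7e^{-x}$, $$\theta_r(P;\mathbf{X}_n)\ \le\ \min\big(\mathfrak{U}_{n,r}(x),\ 1\big).$$ -/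

import Mathlib

open MeasureTheory ProbabilityTheory

namespace MissingMass

noncomputable section

open scoped Classical in
/-- Empirical frequency of the symbol `s` in the sample `X = (X₁, …, Xₙ)`. -/
def freq {S : Type*} {n : ℕ} (X : Fin n → S) (s : S) : ℕ :=
  ∑ i : Fin n, if X i = s then 1 else 0

/-- `M_{n,r}`: number of distinct symbols with frequency exactly `r` in the sample
(used for `r ≥ 1`, so that the set is finite). -/
def numEq {S : Type*} {n : ℕ} (X : Fin n → S) (r : ℕ) : ℕ :=
  {s : S | freq X s = r}.ncard

/-- `C_{n,r}`: number of distinct symbols with frequency at least `r` in the sample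
(used for `r ≥ 1`, so that the set is finite). -/
def numGe {S : Type*} {n : ℕ} (X : Fin n → S) (r : ℕ) : ℕ :=
  {s : S | r ≤ freq X s}.ncard

open scoped Classical in
/-- The `r`-order missing mass `θ_r(P; X)`: the sum of `P({s})^r` over the symbols `s` that do
not occur in the sample. -/
def theta {S : Type*} {n : ℕ} (r : ℕ) (P : PMF S) (X : Fin n → S) : ℝ :=
  ∑' s : S, (P s).toReal ^ r * (if freq X s = 0 then 1 else 0)

/-- The Good–Turing type estimator `M_{n,r} / (n choose r)` of the `r`-order missing mass. -/
def thetaGT {S : Type*} {n : ℕ} (r : ℕ) (X : Fin n → S) : ℝ :=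
  (numEq X r : ℝ) / (n.choose r : ℝ)

def a₁ (n r : ℕ) : ℝ :=
  (n : ℝ) ^ r * (√(2 / (n.choose (2 * r) : ℝ)) + 2 * √2 / (n.choose r : ℝ))

def a₂ (n r : ℕ) : ℝ :=
  (n : ℝ) ^ r * (4 / √(n.choose (2 * r) : ℝ) + (8 + 2 / 3) / (n.choose r : ℝ)
    + 16 * (r : ℝ) / (n.choose (r + 1) : ℝ))

def a₃ (n r : ℕ) : ℝ :=
  (n : ℝ) ^ (1 + r) * (2 * (r : ℝ) / (n.choose (r + 1) : ℝ))

def b₁ (n r : ℕ) : ℝ :=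
  (n : ℝ) ^ r * (√(2 / (n.choose (2 * r) : ℝ)) + 2 * √2 / (n.choose r : ℝ))

def b₂ (n r : ℕ) : ℝ :=
  (n : ℝ) ^ r * (4 / √(n.choose (2 * r) : ℝ) + (8 + 2 / 3) / (n.choose r : ℝ))

/-- The lower confidence bound `𝔏_{n,r}(x)`, a function of the sample only. -/
def lowerBound {S : Type*} {n : ℕ} (r : ℕ) (x : ℝ) (X : Fin n → S) : ℝ :=
  thetaGT r X - a₁ n r / (n : ℝ) ^ r * √((numGe X r : ℝ) * x) - a₂ n r / (n : ℝ) ^ r * x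
    - a₃ n r / (n : ℝ) ^ (1 + r) * (numGe X r : ℝ)

/-- The upper confidence bound `𝔘_{n,r}(x)`, a function of the sample only. -/
def upperBound {S : Type*} {n : ℕ} (r : ℕ) (x : ℝ) (X : Fin n → S) : ℝ :=
  thetaGT r X + b₁ n r / (n : ℝ) ^ r * √((numGe X r : ℝ) * x) + b₂ n r / (n : ℝ) ^ r * x
    + (x + Real.log (n : ℝ)) ^ r / (n : ℝ) ^ r * (2 ^ (r + 1) * x / 3)

end

end MissingMass

namespace MissingMass

open scoped ENNReal
open Filter

/-! The frequencies of an i.i.d. sample are negatively associated (`lintegral_prod_freq_le`). So the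
exponential moment of a weighted sum of indicators of `freq x s ∈ K`, with `K` an upper set or a
lower set, is at most the product of the individual moments. Bernstein-type tails follow as if the
indicators were independent (`weightedCount_lower_tail`, `weightedCount_upper_tail`). They apply to
the missing mass (`K = {0}`) and to the counts `C_r` and `C_{r+1}` (`K = Set.Ici k`). The set `{r}`
is neither upper nor lower, so `M_r` is handled as `C_r - C_{r+1}`.

Comparing binomial probabilities bounds the bias between `E θ_r` and `E M_r / (n choose r)`, as well
as the variance proxy of `θ_r`, in terms of `E C_r`. The lower tail of `C_r` then allows `E C_r` to
be replaced by the observed `C_r`. For the upper bound the weights must be small, so symbols of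
probability above `τ = (x + log n) / n` are dropped; with probability at least `1 - e^{-x}` all of
them occur in the sample. Each side excludes four events of probability at most `e^{-x}`, which is
stronger than the claimed 6 and 7.

All this is done on the countable support of `P`, where every set is measurable, and then
transferred to `S`. -/

/-! ### Negative association of frequencies -/

theorem mul_add_mul_le_of_le {a b c d : ℝ≥0∞} (hab : a ≤ b) (hdc : d ≤ c) :
    a * c + b * d ≤ a * d + b * c := by
  obtain ⟨e, rfl⟩ := exists_add_of_le hab
  obtain ⟨f, rfl⟩ := exists_add_of_le hdc
  calc a * (d + f) + (a + e) * d ≤ a * (d + f) + (a + e) * d + e * f := le_self_add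
    _ = a * d + (a + e) * (d + f) := by ring

/-- Chebyshev's association inequality. -/
theorem lintegral_mul_le_of_antivary {T : Type*} [MeasurableSpace T] (ν : Measure T)
    [IsProbabilityMeasure ν] {F G : T → ℝ≥0∞} (hF : Measurable F) (hG : Measurable G)
    (h : Antivary F G) : ∫⁻ t, F t * G t ∂ν ≤ (∫⁻ t, F t ∂ν) * ∫⁻ t, G t ∂ν := by
  have key : ∀ x y, F x * G x + F y * G y ≤ F x * G y + F y * G x := by
    intro x y
    rcases lt_trichotomy (G x) (G y) with hxy | hxy | hxy
    · have := mul_add_mul_le_of_le (h hxy) hxy.le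
      calc _ = F y * G y + F x * G x := add_comm _ _
        _ ≤ _ := this
        _ = _ := add_comm _ _
    · rw [hxy]
    · exact mul_add_mul_le_of_le (h hxy) hxy.le
  have h2 : ∫⁻ x, ∫⁻ y, (F x * G x + F y * G y) ∂ν ∂ν
      ≤ ∫⁻ x, ∫⁻ y, (F x * G y + F y * G x) ∂ν ∂ν :=
    lintegral_mono fun x => lintegral_mono fun y => key x y
  have e1 : ∫⁻ x, ∫⁻ y, (F x * G x + F y * G y) ∂ν ∂ν = 2 * ∫⁻ t, F t * G t ∂ν := by
    have : ∀ x, ∫⁻ y, (F x * G x + F y * G y) ∂ν = F x * G x + ∫⁻ t, F t * G t ∂ν := by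
      intro x
      rw [lintegral_add_left measurable_const]; simp
    simp_rw [this]
    rw [lintegral_add_right _ measurable_const]
    simp [two_mul]
  have e2 : ∫⁻ x, ∫⁻ y, (F x * G y + F y * G x) ∂ν ∂ν
      = 2 * ((∫⁻ t, F t ∂ν) * ∫⁻ t, G t ∂ν) := by
    have : ∀ x, ∫⁻ y, (F x * G y + F y * G x) ∂ν
        = F x * (∫⁻ t, G t ∂ν) + (∫⁻ t, F t ∂ν) * G x := by
      intro x
      rw [lintegral_add_left (hG.const_mul _), lintegral_const_mul _ hG,
        lintegral_mul_const _ hF]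
    simp_rw [this]
    rw [lintegral_add_left (hF.mul_const _), lintegral_mul_const _ hF,
      lintegral_const_mul _ hG, two_mul]
  rw [e1, e2] at h2
  exact (ENNReal.mul_le_mul_iff_right (by norm_num) (by norm_num)).1 h2

theorem lintegral_pi_succ {T : Type*} [MeasurableSpace T] (ν : Measure T)
    [IsProbabilityMeasure ν] {n : ℕ} {f : (Fin (n + 1) → T) → ℝ≥0∞} (hf : Measurable f) :
    ∫⁻ x, f x ∂(Measure.pi fun _ => ν)
      = ∫⁻ y, ∫⁻ t, f (Fin.cons t y) ∂ν ∂(Measure.pi fun _ : Fin n => ν) := by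
  have h := (measurePreserving_piFinSuccAbove (fun _ : Fin (n + 1) => ν) 0).symm
  rw [← h.lintegral_comp hf, lintegral_prod_symm'
    (fun a => f ((MeasurableEquiv.piFinSuccAbove (fun _ => T) 0).symm a)) (hf.comp h.measurable)]
  simp [MeasurableEquiv.piFinSuccAbove, Fin.consEquiv]

/-- If `F` depends on each coordinate only through the event that it equals `s`, and `F` and `G`
change in opposite directions when a coordinate is set to `s`, then they are negatively
correlated under a product measure. -/
theorem lintegral_pi_mul_le {T : Type*} [Countable T] [MeasurableSpace T]
    [MeasurableSingletonClass T] (ν : Measure T) [IsProbabilityMeasure ν] (s : T)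
    {R : ℝ≥0∞ → ℝ≥0∞ → Prop} (hR : R = (fun a b => a ≤ b) ∨ R = (fun a b => b ≤ a))
    {n : ℕ} (F G : (Fin n → T) → ℝ≥0∞)
    (hF : ∀ x i t t', t ≠ s → t' ≠ s → F (Function.update x i t) = F (Function.update x i t'))
    (hFs : ∀ x i, R (F x) (F (Function.update x i s)))
    (hGs : ∀ x i, R (G (Function.update x i s)) (G x)) :
    ∫⁻ x, F x * G x ∂(Measure.pi fun _ => ν)
      ≤ (∫⁻ x, F x ∂(Measure.pi fun _ => ν)) * ∫⁻ x, G x ∂(Measure.pi fun _ => ν) := by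
  induction n with
  | zero => simp [lintegral_unique]
  | succ n ih =>
    have hint : ∀ f g : T → ℝ≥0∞, (∀ t, R (f t) (g t)) → R (∫⁻ t, f t ∂ν) (∫⁻ t, g t ∂ν) := by
      intro f g hfg
      rcases hR with rfl | rfl <;> exact lintegral_mono hfg
    rw [lintegral_pi_succ ν .of_discrete, lintegral_pi_succ ν .of_discrete,
      lintegral_pi_succ ν .of_discrete]
    -- Chebyshev's inequality decouples the first coordinate; the induction hypothesis applies to
    -- the integrals over that coordinate, which inherit all three hypotheses.
    refine (lintegral_mono fun y => lintegral_mul_le_of_antivary ν .of_discrete .of_discrete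
      ?_).trans (ih _ _ ?_ ?_ ?_)
    · have hFc : ∀ t t', t ≠ s → t' ≠ s →
          F (Fin.cons t y : Fin (n + 1) → T) = F (Fin.cons t' y : Fin (n + 1) → T) := by
        intro t t' ht ht'
        simpa using hF (Fin.cons t y) 0 t t' ht ht'
      have hFc' : ∀ t, R (F (Fin.cons t y : Fin (n + 1) → T))
          (F (Fin.cons s y : Fin (n + 1) → T)) := by
        intro t
        simpa using hFs (Fin.cons t y) 0
      have hGc' : ∀ t, R (G (Fin.cons s y : Fin (n + 1) → T))
          (G (Fin.cons t y : Fin (n + 1) → T)) := by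
        intro t
        simpa using hGs (Fin.cons t y) 0
      -- Along one coordinate `F` has one value at `s` and one common value elsewhere, so only pairs
      -- involving `s` matter, and there `G` moves the opposite way.
      intro t t' hlt
      by_cases ht : t = s
      · subst ht
        rcases hR with rfl | rfl
        · exact hFc' t'
        · exact absurd hlt (hGc' t').not_gt
      · by_cases ht' : t' = s
        · subst ht'
          rcases hR with rfl | rfl
          · exact absurd hlt (hGc' t).not_gt
          · exact hFc' t
        · exact (hFc t' t ht' ht).le
    · intro y i t t' ht ht'
      refine lintegral_congr fun u => ?_
      simpa [Fin.cons_update] using hF (Fin.cons u y) i.succ t t' ht ht'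
    · intro y i
      refine hint _ _ fun u => ?_
      simpa [Fin.cons_update] using hFs (Fin.cons u y) i.succ
    · intro y i
      refine hint _ _ fun u => ?_
      simpa [Fin.cons_update] using hGs (Fin.cons u y) i.succ

theorem freq_update_self {T : Type*} {n : ℕ} (x : Fin n → T) (i : Fin n) (s : T) :
    freq x s ≤ freq (Function.update x i s) s := by
  unfold freq
  refine Finset.sum_le_sum fun j _ => ?_
  by_cases hj : j = i
  · subst hj; simp; split_ifs <;> simp
  · rw [Function.update_of_ne hj]

theorem freq_update_of_ne {T : Type*} {n : ℕ} (x : Fin n → T) (i : Fin n) {s t : T}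
    (h : t ≠ s) : freq (Function.update x i s) t ≤ freq x t := by
  unfold freq
  refine Finset.sum_le_sum fun j _ => ?_
  by_cases hj : j = i
  · subst hj; simp [h.symm]
  · rw [Function.update_of_ne hj]

theorem freq_update_congr {T : Type*} {n : ℕ} (x : Fin n → T) (i : Fin n) {s t t' : T}
    (h : t ≠ s) (h' : t' ≠ s) :
    freq (Function.update x i t) s = freq (Function.update x i t') s := by
  unfold freq
  refine Finset.sum_congr rfl fun j _ => ?_
  by_cases hj : j = i
  · subst hj; simp [h, h']
  · rw [Function.update_of_ne hj, Function.update_of_ne hj]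

/-- Negative association of the frequencies of an i.i.d. sample. -/
theorem lintegral_prod_freq_le {T : Type*} [Countable T] [MeasurableSpace T]
    [MeasurableSingletonClass T] (ν : Measure T) [IsProbabilityMeasure ν] (n : ℕ)
    (g : T → ℕ → ℝ≥0∞) (hg : (∀ s, Monotone (g s)) ∨ ∀ s, Antitone (g s)) (A : Finset T) :
    ∫⁻ x, ∏ s ∈ A, g s (freq x s) ∂(Measure.pi fun _ : Fin n => ν)
      ≤ ∏ s ∈ A, ∫⁻ x, g s (freq x s) ∂(Measure.pi fun _ : Fin n => ν) := by
  classical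
  induction A using Finset.induction_on with
  | empty => simp
  | insert s A hs ih =>
    simp_rw [Finset.prod_insert hs]
    have hne : ∀ t ∈ A, t ≠ s := fun t ht h => hs (h ▸ ht)
    refine le_trans ?_ (mul_le_mul_right ih _)
    -- Setting a coordinate to `s` raises the frequency of `s` and lowers all others, so the factor
    -- at `s` and the remaining product move in opposite directions.
    rcases hg with hg | hg
    · refine lintegral_pi_mul_le ν s (Or.inl rfl) _ _ ?_ ?_ ?_
      · intro x i t t' ht ht'
        rw [freq_update_congr x i ht ht']
      · exact fun x i => hg s (freq_update_self x i s)
      · exact fun x i => Finset.prod_le_prod' fun t ht => hg t (freq_update_of_ne x i (hne t ht))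
    · refine lintegral_pi_mul_le ν s (Or.inr rfl) _ _ ?_ ?_ ?_
      · intro x i t t' ht ht'
        rw [freq_update_congr x i ht ht']
      · exact fun x i => hg s (freq_update_self x i s)
      · exact fun x i => Finset.prod_le_prod' fun t ht => hg t (freq_update_of_ne x i (hne t ht))

/-! ### Scalar exponential inequalities and the Chernoff bound -/

theorem exp_neg_sub_one_le {u : ℝ} (hu : 0 ≤ u) : Real.exp (-u) - 1 ≤ -u + 1 / 2 * u ^ 2 := by
  have h := Real.quadratic_le_exp_of_nonneg hu
  have h0 : 0 < 1 + u + u ^ 2 / 2 := by positivity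
  have h1 : Real.exp (-u) ≤ (1 + u + u ^ 2 / 2)⁻¹ := by
    rw [Real.exp_neg]; exact inv_anti₀ h0 h
  have h2 : (1 + u + u ^ 2 / 2)⁻¹ ≤ 1 - u + u ^ 2 / 2 := by
    rw [inv_le_iff_one_le_mul₀ h0]
    -- The product `(1 + u + u²/2)(1 - u + u²/2)` equals `1 + u⁴/4`.
    nlinarith [sq_nonneg (u ^ 2)]
  linarith

/-- Since `(k + 2)! ≥ 2 * 3 ^ k`, the exponential series from its quadratic term on is dominated by
a geometric series of ratio `u / 3`. -/
theorem exp_sub_one_le_bernstein {u v : ℝ} (hu : 0 ≤ u) (huv : u ≤ v) (hv : v < 3) :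
    Real.exp u - 1 ≤ u + 1 / (2 * (1 - v / 3)) * u ^ 2 := by
  have hs := NormedSpace.expSeries_div_hasSum_exp (𝔸 := ℝ) u
  rw [← Real.exp_eq_exp_ℝ] at hs
  have hs2 := (hasSum_nat_add_iff' 2).2 hs
  have hg := (hasSum_geometric_of_lt_one (by positivity : 0 ≤ u / 3)
    (by linarith : u / 3 < 1)).mul_left (u ^ 2 / 2)
  have hle := hasSum_le (fun k => ?_) hs2 hg
  · have h3 : (1 - u / 3)⁻¹ ≤ (1 - v / 3)⁻¹ := inv_anti₀ (by linarith) (by linarith)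
    have h4 : u ^ 2 / 2 * (1 - u / 3)⁻¹ ≤ u ^ 2 / 2 * (1 - v / 3)⁻¹ := by gcongr
    have h5 : 1 / (2 * (1 - v / 3)) * u ^ 2 = u ^ 2 / 2 * (1 - v / 3)⁻¹ := by
      rw [one_div, mul_inv]; ring
    simp [Finset.sum_range_succ] at hle
    linarith
  · have hf : (2 * 3 ^ k : ℝ) ≤ ((k + 2).factorial : ℝ) := by
      have := Nat.factorial_mul_pow_le_factorial (m := 2) (n := k)
      rw [add_comm 2 k] at this
      exact_mod_cast this
    rw [div_pow, div_mul_div_comm, ← pow_add, add_comm 2 k]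
    exact div_le_div_of_nonneg_left (by positivity) (by positivity) hf

theorem measureReal_le_exp_neg_of_lintegral_exp_le {α : Type*} [MeasurableSpace α]
    {Q : Measure α} [IsProbabilityMeasure Q] {Z : α → ℝ} (hZ : Measurable Z) {b y : ℝ}
    (h : ∫⁻ x, ENNReal.ofReal (Real.exp (Z x)) ∂Q ≤ ENNReal.ofReal (Real.exp b))
    {E : Set α} (hE : ∀ x ∈ E, b + y ≤ Z x) : Q.real E ≤ Real.exp (-y) := by
  have h1 : ENNReal.ofReal (Real.exp (b + y)) * Q E ≤ ENNReal.ofReal (Real.exp b) := by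
    refine le_trans ?_ ((mul_meas_ge_le_lintegral (by fun_prop)
      (ENNReal.ofReal (Real.exp (b + y)))).trans h)
    gcongr
    exact fun x hx => ENNReal.ofReal_le_ofReal (Real.exp_le_exp.2 (hE x hx))
  have h2 := ENNReal.toReal_mono ENNReal.ofReal_ne_top h1
  rw [ENNReal.toReal_mul, ENNReal.toReal_ofReal (Real.exp_pos _).le,
    ENNReal.toReal_ofReal (Real.exp_pos _).le, Real.exp_add, mul_assoc] at h2
  have h3 : Real.exp y * Q.real E ≤ 1 := by
    have := (mul_le_iff_le_one_right (Real.exp_pos b)).1 h2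
    exact this
  rw [Real.exp_neg, ← one_div, le_div_iff₀ (Real.exp_pos y), mul_comm]
  exact h3

/-- The weighted number of symbols whose frequency belongs to `K`. -/
noncomputable def weightedCount {T : Type*} {n : ℕ} (w : T → ℝ) (K : Set ℕ) (x : Fin n → T) : ℝ :=
  ∑' s, w s * K.indicator 1 (freq x s)

/-! ### Exponential moments and tails of weighted counts -/

section

variable {T : Type*} [MeasurableSpace T] (ν : Measure T) (n : ℕ)

/-- The probability that the frequency of `s` in an i.i.d. sample of size `n` belongs to `K`. -/
noncomputable def freqProb (K : Set ℕ) (s : T) : ℝ :=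
  (Measure.pi fun _ : Fin n => ν).real {x | freq x s ∈ K}

theorem freqProb_nonneg (K : Set ℕ) (s : T) : 0 ≤ freqProb ν n K s := measureReal_nonneg

variable [Countable T] [MeasurableSingletonClass T] [IsProbabilityMeasure ν]

/-- A Bernoulli moment `1 + p (e^c - 1)` is at most the Poisson one, by `1 + z ≤ e^z`. -/
theorem lintegral_exp_indicator_le (K : Set ℕ) (s : T) (c : ℝ) :
    ∫⁻ x, ENNReal.ofReal (Real.exp (c * K.indicator 1 (freq x s)))
        ∂(Measure.pi fun _ : Fin n => ν)
      ≤ ENNReal.ofReal (Real.exp (freqProb ν n K s * (Real.exp c - 1))) := by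
  set Q := Measure.pi fun _ : Fin n => ν
  set E : Set (Fin n → T) := {x | freq x s ∈ K} with hE
  have hEm : MeasurableSet E := .of_discrete
  have h1 : ∀ x : Fin n → T, ENNReal.ofReal (Real.exp (c * K.indicator 1 (freq x s)))
      = E.indicator (fun _ => ENNReal.ofReal (Real.exp c)) x + Eᶜ.indicator (fun _ => 1) x := by
    intro x
    by_cases hx : freq x s ∈ K
    · have : x ∈ E := hx
      simp [hx, this]
    · have : x ∉ E := hx
      simp [hx, this]
  simp_rw [h1]
  rw [lintegral_add_left (measurable_const.indicator hEm), lintegral_indicator_const hEm,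
    lintegral_indicator_const hEm.compl, one_mul, ← ofReal_measureReal, ← ofReal_measureReal,
    ← ENNReal.ofReal_mul (Real.exp_pos c).le, ← ENNReal.ofReal_add (by positivity) (by positivity),
    probReal_compl_eq_one_sub hEm]
  refine ENNReal.ofReal_le_ofReal ?_
  have := Real.add_one_le_exp (freqProb ν n K s * (Real.exp c - 1))
  refine le_trans (le_of_eq ?_) this
  simp only [freqProb, Q, E]
  ring

theorem lintegral_exp_sum_le {w : T → ℝ} (hw : ∀ s, 0 ≤ w s) {K : Set ℕ}
    (hK : IsUpperSet K ∨ IsLowerSet K) (l : ℝ) (A : Finset T) :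
    ∫⁻ x, ENNReal.ofReal (Real.exp (l * ∑ s ∈ A, w s * K.indicator 1 (freq x s)))
        ∂(Measure.pi fun _ : Fin n => ν)
      ≤ ENNReal.ofReal (Real.exp (∑ s ∈ A, freqProb ν n K s * (Real.exp (l * w s) - 1))) := by
  have hind : Monotone (K.indicator (1 : ℕ → ℝ)) ∨ Antitone (K.indicator (1 : ℕ → ℝ)) := by
    rcases hK with hK | hK
    · left
      intro a b hab
      by_cases ha : a ∈ K
      · simp [ha, hK hab ha]
      · simpa [ha] using Set.indicator_apply_nonneg (f := (1 : ℕ → ℝ)) fun _ => zero_le_one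
    · right
      intro a b hab
      by_cases hb : b ∈ K
      · simp [hb, hK hab hb]
      · simpa [hb] using Set.indicator_apply_nonneg (f := (1 : ℕ → ℝ)) fun _ => zero_le_one
  have hg : (∀ s, Monotone fun k => ENNReal.ofReal (Real.exp (l * w s * K.indicator 1 k))) ∨
      ∀ s, Antitone fun k => ENNReal.ofReal (Real.exp (l * w s * K.indicator 1 k)) := by
    have hmono : Monotone fun u : ℝ => ENNReal.ofReal (Real.exp u) :=
      fun a b hab => ENNReal.ofReal_le_ofReal (Real.exp_le_exp.2 hab)
    rcases le_total 0 l with hl | hl <;> rcases hind with hind | hind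
    · exact Or.inl fun s => hmono.comp (hind.const_mul (mul_nonneg hl (hw s)))
    · exact Or.inr fun s => hmono.comp_antitone (hind.const_mul (mul_nonneg hl (hw s)))
    · exact Or.inr fun s => hmono.comp_antitone fun a b hab =>
        mul_le_mul_of_nonpos_left (hind hab) (mul_nonpos_of_nonpos_of_nonneg hl (hw s))
    · exact Or.inl fun s => hmono.comp fun a b hab =>
        mul_le_mul_of_nonpos_left (hind hab) (mul_nonpos_of_nonpos_of_nonneg hl (hw s))
  have h := lintegral_prod_freq_le ν n _ hg A
  simp_rw [← ENNReal.ofReal_prod_of_nonneg fun i _ => (Real.exp_pos _).le, ← Real.exp_sum] at h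
  simp_rw [Finset.mul_sum, ← mul_assoc]
  refine h.trans ?_
  rw [Real.exp_sum, ENNReal.ofReal_prod_of_nonneg fun i _ => (Real.exp_pos _).le]
  exact Finset.prod_le_prod' fun s _ => lintegral_exp_indicator_le ν n K s _

theorem lintegral_exp_weightedCount_le {w : T → ℝ} (hw : ∀ s, 0 ≤ w s) {K : Set ℕ}
    (hK : IsUpperSet K ∨ IsLowerSet K)
    (hsum : ∀ x : Fin n → T, Summable fun s => w s * K.indicator 1 (freq x s))
    {m : ℝ} (hm : HasSum (fun s => w s * freqProb ν n K s) m)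
    {V : ℝ} (hV : ∀ A : Finset T, ∑ s ∈ A, w s ^ 2 * freqProb ν n K s ≤ V)
    {l a : ℝ} (ha : 0 ≤ a) (hexp : ∀ s, Real.exp (l * w s) - 1 ≤ l * w s + a * w s ^ 2) :
    ∫⁻ x, ENNReal.ofReal (Real.exp (l * weightedCount w K x)) ∂(Measure.pi fun _ : Fin n => ν)
      ≤ ENNReal.ofReal (Real.exp (l * m + a * V)) := by
  have hcont : Continuous fun u : ℝ => ENNReal.ofReal (Real.exp (l * u)) :=
    ENNReal.continuous_ofReal.comp (by fun_prop)
  -- Fatou's lemma along the finite subsets of `T` passes from finite sums to the whole series.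
  have hZ : ∀ x : Fin n → T, ENNReal.ofReal (Real.exp (l * weightedCount w K x))
      = liminf (fun A : Finset T => ENNReal.ofReal
        (Real.exp (l * ∑ s ∈ A, w s * K.indicator 1 (freq x s)))) atTop := fun x =>
    ((hcont.tendsto _).comp (hsum x).hasSum).liminf_eq.symm
  simp_rw [hZ]
  refine (lintegral_liminf_le fun A => .of_discrete).trans ?_
  have hlim : Tendsto (fun A : Finset T => ENNReal.ofReal (Real.exp
      (l * ∑ s ∈ A, w s * freqProb ν n K s + a * V))) atTop
      (nhds (ENNReal.ofReal (Real.exp (l * m + a * V)))) := by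
    have : Continuous fun u : ℝ => ENNReal.ofReal (Real.exp (l * u + a * V)) :=
      ENNReal.continuous_ofReal.comp (by fun_prop)
    exact (this.tendsto m).comp hm
  rw [← hlim.liminf_eq]
  refine liminf_le_liminf (Eventually.of_forall fun A =>
    (lintegral_exp_sum_le ν n hw hK l A).trans
      (ENNReal.ofReal_le_ofReal (Real.exp_le_exp.2 ?_)))
  calc ∑ s ∈ A, freqProb ν n K s * (Real.exp (l * w s) - 1)
      ≤ ∑ s ∈ A, (l * (w s * freqProb ν n K s) + a * (w s ^ 2 * freqProb ν n K s)) := by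
        refine Finset.sum_le_sum fun s _ => ?_
        have := mul_le_mul_of_nonneg_left (hexp s) (freqProb_nonneg ν n K s)
        linarith
    _ = l * ∑ s ∈ A, w s * freqProb ν n K s + a * ∑ s ∈ A, w s ^ 2 * freqProb ν n K s := by
        rw [Finset.sum_add_distrib, Finset.mul_sum, Finset.mul_sum]
    _ ≤ _ := by gcongr; exact hV A

theorem weightedCount_lower_tail {w : T → ℝ} (hw : ∀ s, 0 ≤ w s) {K : Set ℕ}
    (hK : IsUpperSet K ∨ IsLowerSet K)
    (hsum : ∀ x : Fin n → T, Summable fun s => w s * K.indicator 1 (freq x s))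
    {m : ℝ} (hm : HasSum (fun s => w s * freqProb ν n K s) m)
    {V : ℝ} (hV : ∀ A : Finset T, ∑ s ∈ A, w s ^ 2 * freqProb ν n K s ≤ V) (hV0 : 0 < V)
    {y : ℝ} (hy : 0 < y) :
    (Measure.pi fun _ : Fin n => ν).real {x | weightedCount w K x < m - √(2 * V * y)}
      ≤ Real.exp (-y) := by
  have hq : √(2 * V * y) ^ 2 = 2 * V * y := Real.sq_sqrt (by positivity)
  have hq0 : 0 < √(2 * V * y) := by positivity
  set q := √(2 * V * y)
  -- The minimiser of `-l * q + l ^ 2 * V / 2`. No upper bound on the weights is needed for this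
  -- tail.
  set l := q / V with hl
  have hl0 : 0 < l := by positivity
  refine measureReal_le_exp_neg_of_lintegral_exp_le
    (Z := fun x => -l * weightedCount w K x) .of_discrete
    (lintegral_exp_weightedCount_le ν n hw hK hsum hm hV (a := l ^ 2 / 2) (by positivity)
      fun s => ?_) ?_
  · have := exp_neg_sub_one_le (mul_nonneg hl0.le (hw s))
    rw [neg_mul]
    linarith
  · intro x hx
    have h1 : l * weightedCount w K x ≤ l * (m - q) := by
      gcongr; exact le_of_lt hx
    have h2 : l * q = 2 * y := by
      rw [hl]; field_simp; linarith
    have h3 : l ^ 2 * V = 2 * y := by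
      rw [hl]; field_simp; linarith
    linarith

theorem weightedCount_upper_tail {w : T → ℝ} (hw : ∀ s, 0 ≤ w s) {b : ℝ} (hb : 0 ≤ b)
    (hwb : ∀ s, w s ≤ b) {K : Set ℕ} (hK : IsUpperSet K ∨ IsLowerSet K)
    (hsum : ∀ x : Fin n → T, Summable fun s => w s * K.indicator 1 (freq x s))
    {m : ℝ} (hm : HasSum (fun s => w s * freqProb ν n K s) m)
    {V : ℝ} (hV : ∀ A : Finset T, ∑ s ∈ A, w s ^ 2 * freqProb ν n K s ≤ V) (hV0 : 0 < V)
    {y : ℝ} (hy : 0 < y) :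
    (Measure.pi fun _ : Fin n => ν).real {x | m + √(2 * V * y) + b / 3 * y < weightedCount w K x}
      ≤ Real.exp (-y) := by
  have hq : √(2 * V * y) ^ 2 = 2 * V * y := Real.sq_sqrt (by positivity)
  have hq0 : 0 < √(2 * V * y) := by positivity
  set q := √(2 * V * y)
  have hVq : V = q ^ 2 / (2 * y) := by field_simp; linarith
  set t := 2 * y / q with ht
  have ht0 : 0 < t := by positivity
  have hd : 0 < 1 + b / 3 * t := by positivity
  -- With `t = √(2y / V)`, this choice turns the Bernstein exponent into the exact identity `h2`
  -- below.
  set l := t / (1 + b / 3 * t) with hl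
  have hl0 : 0 < l := by positivity
  have hlb : 1 - l * b / 3 = 1 / (1 + b / 3 * t) := by
    rw [hl]; field_simp; ring
  have hlb0 : 0 < 1 - l * b / 3 := by rw [hlb]; positivity
  refine measureReal_le_exp_neg_of_lintegral_exp_le
    (Z := fun x => l * weightedCount w K x) .of_discrete
    (lintegral_exp_weightedCount_le ν n hw hK hsum hm hV
      (a := 1 / (2 * (1 - l * b / 3)) * l ^ 2) (by positivity) fun s => ?_) ?_
  · have := exp_sub_one_le_bernstein (mul_nonneg hl0.le (hw s))
      (mul_le_mul_of_nonneg_left (hwb s) hl0.le) (by linarith)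
    rw [mul_pow] at this
    linarith
  · intro x hx
    have h1 : l * (m + q + b / 3 * y) ≤ l * weightedCount w K x := by
      gcongr; exact le_of_lt hx
    have h2 : 1 / (2 * (1 - l * b / 3)) * l ^ 2 * V + y = l * (q + b / 3 * y) := by
      rw [hlb, hl, hVq, ht]; field_simp; ring
    linarith

end

/-! ### Symbol counts as weighted counts -/

theorem freq_eq_card {T : Type*} [DecidableEq T] {n : ℕ} (x : Fin n → T) (s : T) :
    freq x s = (Finset.univ.filter fun i => x i = s).card := by
  unfold freq
  rw [Finset.card_filter]
  exact Finset.sum_congr rfl fun i _ => by congr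

theorem finite_setOf_le_freq {T : Type*} {n : ℕ} (x : Fin n → T) {r : ℕ} (hr : 1 ≤ r) :
    {s | r ≤ freq x s}.Finite := by
  classical
  refine (Set.finite_range x).subset fun s hs => ?_
  have h : 0 < freq x s := lt_of_lt_of_le hr hs
  rw [freq_eq_card, Finset.card_pos] at h
  obtain ⟨i, hi⟩ := h
  exact ⟨i, by simpa using hi⟩

theorem hasSum_indicator_Ici_freq {T : Type*} {n : ℕ} (x : Fin n → T) {r : ℕ} (hr : 1 ≤ r) :
    HasSum (fun s => (1 : ℝ) * (Set.Ici r).indicator 1 (freq x s)) (numGe x r) := by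
  have hfin := finite_setOf_le_freq x hr
  have h : HasSum (fun s => (1 : ℝ) * (Set.Ici r).indicator 1 (freq x s))
      (∑ s ∈ hfin.toFinset, (1 : ℝ) * (Set.Ici r).indicator 1 (freq x s)) := by
    refine hasSum_sum_of_ne_finset_zero fun s hs => ?_
    have : freq x s ∉ Set.Ici r := by simpa using hs
    simp [this]
  convert h using 1
  rw [numGe, Set.ncard_eq_toFinset_card _ hfin, Finset.sum_congr rfl (g := fun _ => (1 : ℝ))]
  · simp
  · intro s hs
    have : freq x s ∈ Set.Ici r := by simpa using hs
    simp [Set.mem_Ici.1 this]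

theorem weightedCount_one_Ici {T : Type*} {n : ℕ} (x : Fin n → T) {r : ℕ} (hr : 1 ≤ r) :
    weightedCount (fun _ => 1) (Set.Ici r) x = numGe x r :=
  (hasSum_indicator_Ici_freq x hr).tsum_eq

theorem numEq_add_numGe_succ {T : Type*} {n : ℕ} (x : Fin n → T) {r : ℕ} (hr : 1 ≤ r) :
    numEq x r + numGe x (r + 1) = numGe x r := by
  have hfin := finite_setOf_le_freq x hr
  unfold numEq numGe
  have h1 : {s | freq x s = r}.Finite := hfin.subset fun s hs => le_of_eq (Eq.symm hs)
  have h2 : {s | r + 1 ≤ freq x s}.Finite := hfin.subset fun s hs => (Nat.le_succ r).trans hs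
  rw [← Set.ncard_union_eq ?_ h1 h2]
  · congr 1
    ext s
    simp only [Set.mem_union, Set.mem_ofPred_eq]
    omega
  · rw [Set.disjoint_left]
    intro s hs hs'
    simp only [Set.mem_ofPred_eq] at hs hs'
    omega

theorem tsum_measure_singleton_eq {T : Type*} [Countable T] [MeasurableSpace T]
    [MeasurableSingletonClass T] (ν : Measure T) : ∑' s, ν {s} = ν Set.univ := by
  rw [← Measure.tsum_indicator_apply_singleton ν Set.univ .univ]
  simp

theorem isLowerSet_singleton_zero : IsLowerSet ({0} : Set ℕ) := by
  rintro a b hab rfl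
  exact Nat.le_zero.1 hab

/-! ### Expectations, bias and variance proxies -/

section

variable {T : Type*} [MeasurableSpace T] (ν : Measure T) (n : ℕ)

/-- The weights of the missing mass of order `r` restricted to the symbols of probability at
most `τ`. -/
noncomputable def truncWeight (r : ℕ) (τ : ℝ) (s : T) : ℝ :=
  if ν.real {s} ≤ τ then ν.real {s} ^ r else 0

theorem truncWeight_nonneg (r : ℕ) (τ : ℝ) (s : T) : 0 ≤ truncWeight ν r τ s := by
  unfold truncWeight; split_ifs <;> positivity

theorem truncWeight_le_pow (r : ℕ) (τ : ℝ) (s : T) : truncWeight ν r τ s ≤ ν.real {s} ^ r := by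
  unfold truncWeight; split_ifs <;> first | exact le_rfl | positivity

variable [IsProbabilityMeasure ν]

theorem freqProb_mono {K L : Set ℕ} (h : K ⊆ L) (s : T) : freqProb ν n K s ≤ freqProb ν n L s :=
  measureReal_mono fun _ hx => h hx

theorem freqProb_le_one (K : Set ℕ) (s : T) : freqProb ν n K s ≤ 1 := measureReal_le_one

theorem truncWeight_one (r : ℕ) (s : T) : truncWeight ν r 1 s = ν.real {s} ^ r :=
  if_pos measureReal_le_one

theorem truncWeight_le {r : ℕ} (hr : 1 ≤ r) (τ : ℝ) (s : T) :
    truncWeight ν r τ s ≤ ν.real {s} :=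
  (truncWeight_le_pow ν r τ s).trans
    (pow_le_of_le_one measureReal_nonneg measureReal_le_one (by omega))

theorem weightedCount_truncWeight_eq {r : ℕ} {τ : ℝ} {x : Fin n → T}
    (h : ¬ ∃ s, τ < ν.real {s} ∧ freq x s = 0) :
    weightedCount (truncWeight ν r τ) {0} x = weightedCount (truncWeight ν r 1) {0} x := by
  refine tsum_congr fun s => ?_
  by_cases hs : freq x s = 0
  · have : ν.real {s} ≤ τ := not_lt.1 fun hlt => h ⟨s, hlt, hs⟩
    rw [truncWeight_one, truncWeight, if_pos this]
  · simp [hs]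

variable [Countable T] [MeasurableSingletonClass T]

theorem hasSum_measureReal_singleton : HasSum (fun s => ν.real {s}) 1 := by
  have h := tsum_measure_singleton_eq ν
  rw [measure_univ] at h
  have := ENNReal.hasSum_toReal (f := fun s => ν {s}) (by simp [h])
  rwa [← ENNReal.tsum_toReal_eq fun s => measure_ne_top ν _, h, ENNReal.toReal_one] at this

theorem freqProb_singleton (k : ℕ) (s : T) :
    freqProb ν n {k} s = n.choose k * ν.real {s} ^ k * (1 - ν.real {s}) ^ (n - k) := by
  classical
  -- Partition by the set `I` of positions at which `s` occurs; each piece is a box.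
  have hset : {x : Fin n → T | freq x s ∈ ({k} : Set ℕ)}
      = ⋃ I ∈ Finset.powersetCard k (Finset.univ : Finset (Fin n)),
        Set.univ.pi fun i => if i ∈ I then {s} else {s}ᶜ := by
    ext x
    simp only [Set.mem_ofPred_eq, Set.mem_singleton_iff, Set.mem_iUnion, Set.mem_univ_pi,
      Finset.mem_powersetCard_univ, exists_prop, freq_eq_card]
    constructor
    · intro h
      refine ⟨_, h, fun i => ?_⟩
      by_cases hi : x i = s <;> simp [hi]
    · rintro ⟨I, hI, h⟩
      rw [← hI]
      congr 1
      ext i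
      have := h i
      by_cases hi : i ∈ I <;> simp_all
  have hpi : ∀ I ∈ Finset.powersetCard k (Finset.univ : Finset (Fin n)),
      (Measure.pi fun _ : Fin n => ν).real (Set.univ.pi fun i => if i ∈ I then {s} else {s}ᶜ)
        = ν.real {s} ^ k * (1 - ν.real {s}) ^ (n - k) := by
    intro I hI
    rw [Finset.mem_powersetCard_univ] at hI
    rw [measureReal_def, Measure.pi_pi, ENNReal.toReal_prod]
    have : ∀ i, (ν (if i ∈ I then {s} else {s}ᶜ)).toReal
        = if i ∈ I then ν.real {s} else 1 - ν.real {s} := by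
      intro i
      split_ifs
      · rfl
      · exact probReal_compl_eq_one_sub (.singleton s)
    simp_rw [this]
    rw [Finset.prod_ite]
    simp [Finset.filter_not, Finset.card_sdiff, hI]
  rw [freqProb, hset, measureReal_biUnion_finset, Finset.sum_congr rfl hpi]
  · simp [mul_assoc]
  · intro I _ J _ hIJ
    rw [Function.onFun, Set.disjoint_left]
    intro x hx hx'
    refine hIJ (Finset.ext fun i => ?_)
    have h1 := hx i (Set.mem_univ i)
    have h2 := hx' i (Set.mem_univ i)
    by_cases hi : i ∈ I <;> by_cases hj : i ∈ J <;> simp_all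
  · exact fun I _ => .of_discrete

theorem freqProb_Ici_eq_add (k : ℕ) (s : T) :
    freqProb ν n (Set.Ici k) s = freqProb ν n {k} s + freqProb ν n (Set.Ici (k + 1)) s := by
  unfold freqProb
  rw [← measureReal_union _ .of_discrete]
  · congr 1
    ext x
    simp only [Set.mem_union, Set.mem_ofPred_eq, Set.mem_Ici, Set.mem_singleton_iff]
    omega
  · rw [Set.disjoint_left]
    intro x hx hx'
    simp only [Set.mem_ofPred_eq, Set.mem_Ici, Set.mem_singleton_iff] at hx hx'
    omega

theorem freqProb_Ici_one_le (s : T) : freqProb ν n (Set.Ici 1) s ≤ n * ν.real {s} := by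
  have h0 : freqProb ν n (Set.Ici 0) s = 1 := by simp [freqProb]
  have h1 := freqProb_Ici_eq_add ν n 0 s
  rw [h0, freqProb_singleton] at h1
  have h2 := one_add_mul_le_pow (a := -ν.real {s})
    (by linarith [measureReal_le_one (μ := ν) (s := {s})]) n
  simp only [zero_add, Nat.choose_zero_right, pow_zero, Nat.sub_zero, Nat.cast_one, one_mul] at h1
  rw [← sub_eq_add_neg] at h2
  linarith

theorem summable_freqProb_Ici {r : ℕ} (hr : 1 ≤ r) :
    Summable fun s => freqProb ν n (Set.Ici r) s :=
  Summable.of_nonneg_of_le (fun s => freqProb_nonneg ν n _ s)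
    (fun s => (freqProb_mono ν n (Set.Ici_subset_Ici.2 hr) s).trans (freqProb_Ici_one_le ν n s))
    ((hasSum_measureReal_singleton ν).summable.mul_left _)

/-- The expected number of symbols with frequency at least `r`. -/
noncomputable def expNumGe (r : ℕ) : ℝ := ∑' s, freqProb ν n (Set.Ici r) s

theorem hasSum_freqProb_Ici {r : ℕ} (hr : 1 ≤ r) :
    HasSum (fun s => freqProb ν n (Set.Ici r) s) (expNumGe ν n r) :=
  (summable_freqProb_Ici ν n hr).hasSum

theorem hasSum_freqProb_singleton {r : ℕ} (hr : 1 ≤ r) :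
    HasSum (fun s => freqProb ν n {r} s) (expNumGe ν n r - expNumGe ν n (r + 1)) := by
  have h := (hasSum_freqProb_Ici ν n hr).sub (hasSum_freqProb_Ici ν n (hr.trans (Nat.le_succ r)))
  refine h.congr_fun ?_
  intro s
  rw [freqProb_Ici_eq_add ν n r]; ring

theorem expNumGe_pos {r : ℕ} (hr : 1 ≤ r) (hrn : r ≤ n) : 0 < expNumGe ν n r := by
  obtain ⟨s, hs⟩ : ∃ s, 0 < ν.real {s} := by
    by_contra! h
    have h0 : (fun s => ν.real {s}) = fun _ => 0 :=
      funext fun s => le_antisymm (h s) measureReal_nonneg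
    have h1 := hasSum_measureReal_singleton ν
    rw [h0] at h1
    exact zero_ne_one (hasSum_zero.unique h1)
  refine (summable_freqProb_Ici ν n hr).tsum_pos (fun s => freqProb_nonneg ν n _ s) s ?_
  -- The sample may consist of `s` alone, with probability `ν.real {s} ^ n > 0`.
  refine lt_of_lt_of_le ?_ (freqProb_mono ν n (K := {n}) (by simpa using hrn) s)
  rw [freqProb_singleton]
  simp only [Nat.choose_self, Nat.cast_one, one_mul, Nat.sub_self, pow_zero, mul_one]
  positivity

theorem sum_freqProb_Ici_le {r k : ℕ} (hr : 1 ≤ r) (hk : r ≤ k) (A : Finset T) :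
    ∑ s ∈ A, freqProb ν n (Set.Ici k) s ≤ expNumGe ν n r :=
  (Finset.sum_le_sum fun s _ => freqProb_mono ν n (Set.Ici_subset_Ici.2 hk) s).trans
    ((summable_freqProb_Ici ν n hr).sum_le_tsum _ fun s _ => freqProb_nonneg ν n _ s)

/-- Allowing `k ≥ r` with the variance proxy at `r` expresses the deviations of both `C_r` and
`C_{r+1}` through `E C_r`. -/
theorem numGe_lower_tail {r k : ℕ} (hr : 1 ≤ r) (hk : r ≤ k) (hrn : r ≤ n) {y : ℝ} (hy : 0 < y) :
    (Measure.pi fun _ : Fin n => ν).real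
      {x | (numGe x k : ℝ) < expNumGe ν n k - √(2 * expNumGe ν n r * y)} ≤ Real.exp (-y) := by
  have h := weightedCount_lower_tail ν n (w := fun _ => 1) (fun _ => zero_le_one)
    (K := Set.Ici k) (Or.inl (isUpperSet_Ici k))
    (fun x => (hasSum_indicator_Ici_freq x (hr.trans hk)).summable)
    (by simpa using hasSum_freqProb_Ici ν n (hr.trans hk))
    (V := expNumGe ν n r) (by simpa using sum_freqProb_Ici_le ν n hr hk)
    (expNumGe_pos ν n hr hrn) hy
  simpa only [weightedCount_one_Ici _ (hr.trans hk)] using h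

theorem numGe_upper_tail {r k : ℕ} (hr : 1 ≤ r) (hk : r ≤ k) (hrn : r ≤ n) {y : ℝ} (hy : 0 < y) :
    (Measure.pi fun _ : Fin n => ν).real
      {x | expNumGe ν n k + √(2 * expNumGe ν n r * y) + 1 / 3 * y < (numGe x k : ℝ)}
        ≤ Real.exp (-y) := by
  have h := weightedCount_upper_tail ν n (w := fun _ => 1) (fun _ => zero_le_one)
    zero_le_one (fun _ => le_rfl)
    (K := Set.Ici k) (Or.inl (isUpperSet_Ici k))
    (fun x => (hasSum_indicator_Ici_freq x (hr.trans hk)).summable)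
    (by simpa using hasSum_freqProb_Ici ν n (hr.trans hk))
    (V := expNumGe ν n r) (by simpa using sum_freqProb_Ici_le ν n hr hk)
    (expNumGe_pos ν n hr hrn) hy
  simpa only [weightedCount_one_Ici _ (hr.trans hk)] using h

theorem summable_truncWeight_mul {r : ℕ} (hr : 1 ≤ r) (τ : ℝ) {f : T → ℝ} (hf0 : ∀ s, 0 ≤ f s)
    (hf1 : ∀ s, f s ≤ 1) : Summable fun s => truncWeight ν r τ s * f s :=
  Summable.of_nonneg_of_le (fun s => mul_nonneg (truncWeight_nonneg ν r τ s) (hf0 s))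
    (fun s => (mul_le_of_le_one_right (truncWeight_nonneg ν r τ s) (hf1 s)).trans
      (truncWeight_le ν hr τ s))
    (hasSum_measureReal_singleton ν).summable

theorem summable_truncWeight_indicator {r : ℕ} (hr : 1 ≤ r) (τ : ℝ) (K : Set ℕ) (x : Fin n → T) :
    Summable fun s => truncWeight ν r τ s * K.indicator 1 (freq x s) := by
  refine summable_truncWeight_mul ν hr τ (fun s => ?_) fun s => ?_
  · exact Set.indicator_apply_nonneg (f := (1 : ℕ → ℝ)) fun _ => zero_le_one
  · exact Set.indicator_apply_le' (f := (1 : ℕ → ℝ)) (fun _ => le_rfl) fun _ => zero_le_one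

theorem summable_truncWeight_freqProb {r : ℕ} (hr : 1 ≤ r) (τ : ℝ) (K : Set ℕ) :
    Summable fun s => truncWeight ν r τ s * freqProb ν n K s :=
  summable_truncWeight_mul ν hr τ (fun s => freqProb_nonneg ν n K s)
    fun s => freqProb_le_one ν n K s

theorem freqProb_zero (s : T) : freqProb ν n {0} s = (1 - ν.real {s}) ^ n := by
  simp [freqProb_singleton]

theorem pow_mul_freqProb_zero_le {k : ℕ} (hk : k ≤ n) (s : T) :
    ν.real {s} ^ k * freqProb ν n {0} s ≤ freqProb ν n {k} s / n.choose k := by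
  have hc : (0 : ℝ) < n.choose k := by exact_mod_cast Nat.choose_pos hk
  have h1 : ν.real {s} ≤ 1 := measureReal_le_one
  have h0 : 0 ≤ ν.real {s} := measureReal_nonneg
  rw [freqProb_zero, freqProb_singleton, mul_assoc, mul_div_cancel_left₀ _ hc.ne']
  exact mul_le_mul_of_nonneg_left
    (pow_le_pow_of_le_one (by linarith) (by linarith) (Nat.sub_le n k)) (by positivity)

/-- Bernoulli's inequality `(1 - p)^r ≥ 1 - r p` costs at most `r p^{r+1} (1 - p)^{n-r-1}`, a
multiple of the probability of frequency `r + 1`. Enlarging that event to `Set.Ici r` makes the bias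
summable to a multiple of `E C_r`. -/
theorem le_pow_mul_freqProb_zero {r : ℕ} (hrn : r + 1 ≤ n) (s : T) :
    freqProb ν n {r} s / n.choose r - r / n.choose (r + 1) * freqProb ν n (Set.Ici r) s
      ≤ ν.real {s} ^ r * freqProb ν n {0} s := by
  have hc : (0 : ℝ) < n.choose r := by exact_mod_cast Nat.choose_pos (by omega)
  have hc' : (0 : ℝ) < n.choose (r + 1) := by exact_mod_cast Nat.choose_pos hrn
  have h1 : ν.real {s} ≤ 1 := measureReal_le_one
  have h0 : 0 ≤ ν.real {s} := measureReal_nonneg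
  have hle : freqProb ν n {r + 1} s ≤ freqProb ν n (Set.Ici r) s :=
    freqProb_mono ν n (by simp) s
  have hle' : r / n.choose (r + 1) * freqProb ν n {r + 1} s
      ≤ r / n.choose (r + 1) * freqProb ν n (Set.Ici r) s := by gcongr
  refine le_trans (sub_le_sub_left hle' _) ?_
  rw [freqProb_zero, freqProb_singleton, freqProb_singleton, mul_assoc,
    mul_div_cancel_left₀ _ hc.ne', mul_assoc, ← mul_assoc (_ / _), div_mul_cancel₀ _ hc'.ne']
  set p := ν.real {s}
  obtain ⟨m, rfl⟩ := Nat.exists_eq_add_of_le hrn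
  rw [show r + 1 + m - r = m + 1 by omega, show r + 1 + m - (r + 1) = m by omega,
    show r + 1 + m = (m + 1) + r by omega, pow_add (1 - p) (m + 1) r]
  have hb := one_add_mul_le_pow (a := -p) (by linarith) r
  rw [← sub_eq_add_neg] at hb
  have hq : 0 ≤ 1 - p := by linarith
  have hb' : (1 - p) ^ (m + 1) * (1 - r * p) ≤ (1 - p) ^ (m + 1) * (1 - p) ^ r := by
    gcongr; linarith
  have hm : r * p * (1 - p) ^ (m + 1) ≤ r * p * (1 - p) ^ m :=
    mul_le_mul_of_nonneg_left (pow_le_pow_of_le_one hq (by linarith) (Nat.le_succ m))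
      (by positivity)
  have : p ^ r * ((1 - p) ^ (m + 1) - r * p * (1 - p) ^ m)
      ≤ p ^ r * ((1 - p) ^ (m + 1) * (1 - p) ^ r) := by
    gcongr; linarith
  calc _ = p ^ r * ((1 - p) ^ (m + 1) - r * p * (1 - p) ^ m) := by ring
    _ ≤ _ := this

/-- The expectation of the missing mass restricted to the symbols of probability at most `τ`. -/
noncomputable def expMass (r : ℕ) (τ : ℝ) : ℝ :=
  ∑' s, truncWeight ν r τ s * freqProb ν n {0} s

theorem expMass_le {r : ℕ} (hr : 1 ≤ r) (hrn : r ≤ n) (τ : ℝ) :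
    expMass ν n r τ ≤ (expNumGe ν n r - expNumGe ν n (r + 1)) / n.choose r :=
  hasSum_le (fun s => (mul_le_mul_of_nonneg_right (truncWeight_le_pow ν r τ s)
      (freqProb_nonneg ν n _ s)).trans (pow_mul_freqProb_zero_le ν n hrn s))
    (summable_truncWeight_freqProb ν n hr τ {0}).hasSum
    ((hasSum_freqProb_singleton ν n hr).div_const _)

theorem le_expMass_one {r : ℕ} (hr : 1 ≤ r) (hrn : r + 1 ≤ n) :
    (expNumGe ν n r - expNumGe ν n (r + 1)) / n.choose r
      - r / n.choose (r + 1) * expNumGe ν n r ≤ expMass ν n r 1 :=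
  hasSum_le (fun s => by rw [truncWeight_one]; exact le_pow_mul_freqProb_zero ν n hrn s)
    (((hasSum_freqProb_singleton ν n hr).div_const _).sub
      ((hasSum_freqProb_Ici ν n hr).mul_left _))
    (summable_truncWeight_freqProb ν n hr 1 {0}).hasSum

/-- Squared weights `p^{2r}` convert absence into frequency exactly `2r`, an event inside `Set.Ici
r`; this is the source of `n.choose (2 * r)` in the bounds. -/
theorem sum_truncWeight_sq_le {r : ℕ} (hr : 1 ≤ r) (hrn : 2 * r ≤ n) (τ : ℝ) (A : Finset T) :
    ∑ s ∈ A, truncWeight ν r τ s ^ 2 * freqProb ν n {0} s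
      ≤ expNumGe ν n r / n.choose (2 * r) := by
  refine le_trans (Finset.sum_le_sum fun s _ => ?_)
    ((Finset.sum_div _ _ _).ge.trans
      (div_le_div_of_nonneg_right (sum_freqProb_Ici_le ν n hr le_rfl A) (Nat.cast_nonneg _)))
  calc truncWeight ν r τ s ^ 2 * freqProb ν n {0} s
      ≤ (ν.real {s} ^ r) ^ 2 * freqProb ν n {0} s := by
        gcongr
        · exact freqProb_nonneg ν n _ s
        · exact truncWeight_nonneg ν r τ s
        · exact truncWeight_le_pow ν r τ s
    _ = ν.real {s} ^ (2 * r) * freqProb ν n {0} s := by rw [← pow_mul, mul_comm r 2]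
    _ ≤ freqProb ν n {2 * r} s / n.choose (2 * r) := pow_mul_freqProb_zero_le ν n hrn s
    _ ≤ _ := div_le_div_of_nonneg_right
        (freqProb_mono ν n (by simp; omega) s) (Nat.cast_nonneg _)

theorem missingMass_lower_tail {r : ℕ} (hr : 1 ≤ r) (hrn : 2 * r ≤ n) {y : ℝ} (hy : 0 < y) :
    (Measure.pi fun _ : Fin n => ν).real
      {x | weightedCount (truncWeight ν r 1) {0} x
        < expMass ν n r 1 - √(2 * (expNumGe ν n r / n.choose (2 * r)) * y)} ≤ Real.exp (-y) :=
  weightedCount_lower_tail ν n (truncWeight_nonneg ν r 1) (Or.inr isLowerSet_singleton_zero)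
    (summable_truncWeight_indicator ν n hr 1 {0})
    (summable_truncWeight_freqProb ν n hr 1 {0}).hasSum
    (sum_truncWeight_sq_le ν n hr hrn 1)
    (div_pos (expNumGe_pos ν n hr (by omega)) (by exact_mod_cast Nat.choose_pos hrn)) hy

theorem missingMass_upper_tail {r : ℕ} (hr : 1 ≤ r) (hrn : 2 * r ≤ n) {τ : ℝ} (hτ : 0 ≤ τ)
    {y : ℝ} (hy : 0 < y) :
    (Measure.pi fun _ : Fin n => ν).real
      {x | expMass ν n r τ + √(2 * (expNumGe ν n r / n.choose (2 * r)) * y) + τ ^ r / 3 * y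
        < weightedCount (truncWeight ν r τ) {0} x} ≤ Real.exp (-y) := by
  refine weightedCount_upper_tail ν n (truncWeight_nonneg ν r τ) (pow_nonneg hτ r) (fun s => ?_)
    (Or.inr isLowerSet_singleton_zero)
    (summable_truncWeight_indicator ν n hr τ {0})
    (summable_truncWeight_freqProb ν n hr τ {0}).hasSum
    (sum_truncWeight_sq_le ν n hr hrn τ)
    (div_pos (expNumGe_pos ν n hr (by omega)) (by exact_mod_cast Nat.choose_pos hrn)) hy
  unfold truncWeight
  split_ifs with h
  · exact pow_le_pow_left₀ measureReal_nonneg h r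
  · exact pow_nonneg hτ r

/-- A union bound in which each relevant symbol is charged `p / τ ≥ 1`, so that the total is
governed by `∑ p = 1` and not by the number of symbols. -/
theorem exists_large_missing_le {τ : ℝ} (hτ : 0 < τ) :
    (Measure.pi fun _ : Fin n => ν).real {x | ∃ s, τ < ν.real {s} ∧ freq x s = 0}
      ≤ Real.exp (-(n * τ)) / τ := by
  set Q := Measure.pi fun _ : Fin n => ν
  have h : Q {x | ∃ s, τ < ν.real {s} ∧ freq x s = 0}
      ≤ ENNReal.ofReal (Real.exp (-(n * τ)) / τ) := by
    rw [Set.ofPred_exists]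
    refine (measure_iUnion_le _).trans ?_
    calc ∑' s, Q {x | τ < ν.real {s} ∧ freq x s = 0}
        ≤ ∑' s, ENNReal.ofReal (Real.exp (-(n * τ)) / τ) * ν {s} := by
          refine ENNReal.tsum_le_tsum fun s => ?_
          by_cases hs : τ < ν.real {s}
          · simp only [hs, true_and]
            have hq : Q {x | freq x s = 0} = ENNReal.ofReal ((1 - ν.real {s}) ^ n) := by
              rw [← freqProb_zero, freqProb, ofReal_measureReal]; rfl
            rw [hq, ← ofReal_measureReal (μ := ν), ← ENNReal.ofReal_mul (by positivity)]
            refine ENNReal.ofReal_le_ofReal ?_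
            have h1 : (1 - ν.real {s}) ^ n ≤ Real.exp (-(n * τ)) := by
              rw [← mul_neg, Real.exp_nat_mul]
              refine pow_le_pow_left₀ (sub_nonneg.2 measureReal_le_one) ?_ n
              linarith [Real.add_one_le_exp (-τ)]
            rw [div_mul_eq_mul_div, le_div_iff₀ hτ]
            exact mul_le_mul h1 hs.le hτ.le (Real.exp_pos _).le
          · simp [hs]
      _ = _ := by rw [ENNReal.tsum_mul_left, tsum_measure_singleton_eq, measure_univ, mul_one]
  exact ENNReal.toReal_le_of_le_ofReal (by positivity) h

end

/-! ### Deterministic inequalities on the typical event -/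

/-- With `u = √(E x)` and `g = √(C x)` the hypothesis reads `u (u - √2 x) ≤ g²`, which fails once `u
> g + √2 x`. It trades the unknown expectation for the observed count. -/
theorem sqrt_mul_le_of_sub_sqrt_le {E C x : ℝ} (hE : 0 ≤ E) (hC : 0 ≤ C) (hx : 0 < x)
    (h : E - √(2 * E * x) ≤ C) : √(E * x) ≤ √(C * x) + √2 * x := by
  have h2 : √2 ^ 2 = 2 := Real.sq_sqrt (by norm_num)
  have hh : √(E * x) ^ 2 = E * x := Real.sq_sqrt (by positivity)
  have hg : √(C * x) ^ 2 = C * x := Real.sq_sqrt (by positivity)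
  rw [mul_assoc, Real.sqrt_mul (by norm_num)] at h
  have hg0 := Real.sqrt_nonneg (C * x)
  have h20 := Real.sqrt_pos.2 (show (0 : ℝ) < 2 by norm_num)
  set g := √(C * x)
  set u := √(E * x)
  by_contra! hlt
  have h3 : u * (u - √2 * x) ≤ g ^ 2 := by nlinarith
  have h4 : (g + √2 * x) * g ≤ u * (u - √2 * x) :=
    mul_le_mul hlt.le (by linarith) hg0 (by linarith [mul_pos h20 hx])
  rcases hg0.eq_or_lt with h0 | h0
  · rw [← h0] at h3 hlt
    have : 0 < √2 * x := mul_pos h20 hx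
    nlinarith
  · nlinarith [mul_pos (mul_pos h20 hx) h0]

theorem le_two_mul_add_of_sub_sqrt_le {E C x : ℝ} (hE : 0 ≤ E) (hx : 0 < x)
    (h : E - √(2 * E * x) ≤ C) : E ≤ 2 * C + 2 * x := by
  have : √(2 * E * x) ≤ E / 2 + x := by
    refine Real.sqrt_le_iff.2 ⟨by positivity, ?_⟩
    nlinarith [sq_nonneg (E / 2 - x)]
  linarith

theorem sqrt_variance_eq {E N x : ℝ} (hE : 0 ≤ E) (hx : 0 ≤ x) :
    √(2 * (E / N) * x) = √2 * (√N)⁻¹ * √(E * x) := by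
  rw [show 2 * (E / N) * x = 2 * (E * x / N) by ring, Real.sqrt_mul (by norm_num),
    Real.sqrt_div (by positivity)]
  ring

theorem lower_of_typical {r x N₁ N₂ N₃ E E' C C' m θ : ℝ} (hr : 0 ≤ r) (hx : 0 < x)
    (hN₁ : 0 < N₁) (hN₂ : 0 < N₂) (hN₃ : 0 < N₃) (hE : 0 ≤ E) (hC : 0 ≤ C)
    (hCl : E - √(2 * E * x) ≤ C) (hCu : C ≤ E + √(2 * E * x) + 1 / 3 * x)
    (hCl' : E' - √(2 * E * x) ≤ C') (hm : (E - E') / N₁ - r / N₃ * E ≤ m)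
    (hθ : m - √(2 * (E / N₂) * x) ≤ θ) :
    (C - C') / N₁ - (√(2 / N₂) + 2 * √2 / N₁) * √(C * x)
      - (4 / √N₂ + (8 + 2 / 3) / N₁ + 16 * r / N₃) * x - 2 * r / N₃ * C ≤ θ := by
  have hs := sqrt_mul_le_of_sub_sqrt_le hE hC hx hCl
  have hE2 := le_two_mul_add_of_sub_sqrt_le hE hx hCl
  have h2 : √2 * √2 = 2 := Real.mul_self_sqrt (by norm_num)
  have h20 := Real.sqrt_nonneg 2
  rw [sqrt_variance_eq hE hx.le] at hθ
  rw [mul_assoc 2 E x, Real.sqrt_mul (by norm_num)] at hCl hCu hCl'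
  rw [Real.sqrt_div (by norm_num)]
  have hu : 0 < (√N₂)⁻¹ := by positivity
  have hv : 0 < N₁⁻¹ := by positivity
  have hz : 0 < N₃⁻¹ := by positivity
  have e1 : (C - C' - 2 * (√2 * √(C * x) + 2 * x) - 1 / 3 * x) * N₁⁻¹
      ≤ (E - E') * N₁⁻¹ := by
    refine mul_le_mul_of_nonneg_right ?_ hv.le
    have := mul_le_mul_of_nonneg_left hs h20
    rw [mul_add, ← mul_assoc √2 √2, h2] at this
    linarith
  have e2 : √2 * (√N₂)⁻¹ * √(E * x) ≤ (√N₂)⁻¹ * (√2 * √(C * x) + 2 * x) := by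
    have := mul_le_mul_of_nonneg_left hs (mul_nonneg h20 hu.le)
    refine this.trans (le_of_eq ?_)
    linear_combination (√N₂)⁻¹ * x * h2
  have e3 : r * N₃⁻¹ * E ≤ r * N₃⁻¹ * (2 * C + 2 * x) := by gcongr
  -- The argument yields 2, 4 + 1/3 and 2 where the statement has 4, 8 + 2/3 and 16; these three
  -- terms absorb the slack.
  have p1 : 0 ≤ (√N₂)⁻¹ * x := by positivity
  have p2 : 0 ≤ N₁⁻¹ * x := by positivity
  have p3 : 0 ≤ r * N₃⁻¹ * x := by positivity
  simp only [div_eq_mul_inv] at *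
  linarith

theorem upper_of_typical {x N₁ N₂ E E' C C' m θ w : ℝ} (hx : 0 < x)
    (hN₁ : 0 < N₁) (hN₂ : 0 < N₂) (hE : 0 ≤ E) (hC : 0 ≤ C)
    (hCl : E - √(2 * E * x) ≤ C) (hCu' : C' ≤ E' + √(2 * E * x) + 1 / 3 * x)
    (hm : m ≤ (E - E') / N₁) (hθ : θ ≤ m + √(2 * (E / N₂) * x) + w / 3 * x) :
    θ ≤ (C - C') / N₁ + (√(2 / N₂) + 2 * √2 / N₁) * √(C * x)
      + (4 / √N₂ + (8 + 2 / 3) / N₁) * x + w / 3 * x := by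
  have hs := sqrt_mul_le_of_sub_sqrt_le hE hC hx hCl
  have h2 : √2 * √2 = 2 := Real.mul_self_sqrt (by norm_num)
  have h20 := Real.sqrt_nonneg 2
  rw [sqrt_variance_eq hE hx.le] at hθ
  rw [mul_assoc 2 E x, Real.sqrt_mul (by norm_num)] at hCl hCu'
  rw [Real.sqrt_div (by norm_num)]
  have hu : 0 < (√N₂)⁻¹ := by positivity
  have hv : 0 < N₁⁻¹ := by positivity
  have e1 : (E - E') * N₁⁻¹
      ≤ (C - C' + 2 * (√2 * √(C * x) + 2 * x) + 1 / 3 * x) * N₁⁻¹ := by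
    refine mul_le_mul_of_nonneg_right ?_ hv.le
    have := mul_le_mul_of_nonneg_left hs h20
    rw [mul_add, ← mul_assoc √2 √2, h2] at this
    linarith
  have e2 : √2 * (√N₂)⁻¹ * √(E * x) ≤ (√N₂)⁻¹ * (√2 * √(C * x) + 2 * x) := by
    have := mul_le_mul_of_nonneg_left hs (mul_nonneg h20 hu.le)
    refine this.trans (le_of_eq ?_)
    linear_combination (√N₂)⁻¹ * x * h2
  have p1 : 0 ≤ (√N₂)⁻¹ * x := by positivity
  have p2 : 0 ≤ N₁⁻¹ * x := by positivity
  simp only [div_eq_mul_inv] at *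
  linarith

theorem lowerBound_eq {S : Type*} {n r : ℕ} (hr : 1 ≤ r) (hn : 0 < n) (x : ℝ) (y : Fin n → S) :
    lowerBound r x y = ((numGe y r : ℝ) - numGe y (r + 1)) / n.choose r
      - (√(2 / n.choose (2 * r)) + 2 * √2 / n.choose r) * √(numGe y r * x)
      - (4 / √(n.choose (2 * r)) + (8 + 2 / 3) / n.choose r + 16 * r / n.choose (r + 1)) * x
      - 2 * r / n.choose (r + 1) * numGe y r := by
  have hn' : (n : ℝ) ≠ 0 := by positivity
  have h : (numEq y r : ℝ) = numGe y r - numGe y (r + 1) :=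
    eq_sub_of_add_eq (by exact_mod_cast numEq_add_numGe_succ y hr)
  rw [lowerBound, thetaGT, a₁, a₂, a₃, h, mul_div_cancel_left₀ _ (pow_ne_zero _ hn'),
    mul_div_cancel_left₀ _ (pow_ne_zero _ hn'), mul_div_cancel_left₀ _ (pow_ne_zero _ hn')]

theorem upperBound_eq {S : Type*} {n r : ℕ} (hr : 1 ≤ r) (hn : 0 < n) (x : ℝ) (y : Fin n → S) :
    upperBound r x y = ((numGe y r : ℝ) - numGe y (r + 1)) / n.choose r
      + (√(2 / n.choose (2 * r)) + 2 * √2 / n.choose r) * √(numGe y r * x)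
      + (4 / √(n.choose (2 * r)) + (8 + 2 / 3) / n.choose r) * x
      + ((x + Real.log n) / n) ^ r * (2 ^ (r + 1) * x / 3) := by
  have hn' : (n : ℝ) ≠ 0 := by positivity
  have h : (numEq y r : ℝ) = numGe y r - numGe y (r + 1) :=
    eq_sub_of_add_eq (by exact_mod_cast numEq_add_numGe_succ y hr)
  rw [upperBound, thetaGT, b₁, b₂, h, mul_div_cancel_left₀ _ (pow_ne_zero _ hn'),
    mul_div_cancel_left₀ _ (pow_ne_zero _ hn'), div_pow]

theorem one_sub_four_mul_le {α : Type*} [MeasurableSpace α] {Q : Measure α}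
    [IsProbabilityMeasure Q] {A B C D G : Set α} {δ : ℝ} (hA : Q.real A ≤ δ) (hB : Q.real B ≤ δ)
    (hC : Q.real C ≤ δ) (hD : Q.real D ≤ δ)
    (h : ∀ y, y ∉ A → y ∉ B → y ∉ C → y ∉ D → y ∈ G) : 1 - 4 * δ ≤ Q.real G := by
  have hsub : (Set.univ : Set α) ⊆ G ∪ (A ∪ B ∪ (C ∪ D)) := by
    intro y _
    by_contra hy
    simp only [Set.mem_union, not_or] at hy
    exact hy.1 (h y hy.2.1.1 hy.2.1.2 hy.2.2.1 hy.2.2.2)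
  have h1 := measureReal_mono (μ := Q) hsub
  rw [probReal_univ] at h1
  linarith [measureReal_union_le (μ := Q) G (A ∪ B ∪ (C ∪ D)),
    measureReal_union_le (μ := Q) (A ∪ B) (C ∪ D), measureReal_union_le (μ := Q) A B,
    measureReal_union_le (μ := Q) C D]

/-! ### Confidence bounds over a countable alphabet -/

section

variable {T : Type*} [Countable T] [MeasurableSpace T] [MeasurableSingletonClass T]
  (ν : Measure T) [IsProbabilityMeasure ν] {n r : ℕ}

theorem lowerBound_confidence (hr : 1 ≤ r) (hn : 2 * r < n) {x : ℝ} (hx : 0 < x) :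
    1 - 4 * Real.exp (-x) ≤ (Measure.pi fun _ : Fin n => ν).real
      {y | lowerBound r x y ≤ weightedCount (truncWeight ν r 1) {0} y} := by
  refine one_sub_four_mul_le (numGe_lower_tail ν n hr le_rfl (by omega) hx)
    (numGe_upper_tail ν n hr le_rfl (by omega) hx)
    (numGe_lower_tail ν n hr (Nat.le_succ r) (by omega) hx)
    (missingMass_lower_tail ν n hr hn.le hx) fun y h1 h2 h3 h4 => ?_
  rw [Set.mem_ofPred_eq, not_lt] at h1 h2 h3 h4
  rw [Set.mem_ofPred_eq, lowerBound_eq hr (by omega)]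
  exact lower_of_typical (Nat.cast_nonneg r) hx
    (by exact_mod_cast Nat.choose_pos (by omega)) (by exact_mod_cast Nat.choose_pos (by omega))
    (by exact_mod_cast Nat.choose_pos (by omega)) (expNumGe_pos ν n hr (by omega)).le
    (Nat.cast_nonneg _) h1 h2 h3 (le_expMass_one ν n hr (by omega)) h4

theorem upperBound_confidence (hr : 1 ≤ r) (hn : 2 * r < n) {x : ℝ} (hx : 0 < x) :
    1 - 4 * Real.exp (-x) ≤ (Measure.pi fun _ : Fin n => ν).real
      {y | weightedCount (truncWeight ν r 1) {0} y ≤ upperBound r x y} := by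
  have hn0 : (0 : ℝ) < n := by exact_mod_cast (by omega : 0 < n)
  -- Here `n ≥ 3 > e`. Hence `τ ≥ 1 / n`, so that `e^{-nτ} / τ = e^{-x} / (n τ) ≤ e^{-x}`.
  have hlog : 1 ≤ Real.log n := by
    rw [Real.le_log_iff_exp_le hn0]
    have : (3 : ℝ) ≤ n := by exact_mod_cast (by omega : 3 ≤ n)
    linarith [Real.exp_one_lt_d9]
  set τ := (x + Real.log n) / n with hτdef
  have hτ : 0 < τ := by positivity
  have hlarge : Real.exp (-(n * τ)) / τ ≤ Real.exp (-x) := by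
    have h1 : n * τ = x + Real.log n := by rw [hτdef]; field_simp
    rw [h1, neg_add, Real.exp_add, Real.exp_neg (Real.log n), Real.exp_log hn0, div_le_iff₀ hτ,
      hτdef]
    gcongr
    rw [inv_eq_one_div]
    gcongr
    linarith
  refine one_sub_four_mul_le (numGe_lower_tail ν n hr le_rfl (by omega) hx)
    (numGe_upper_tail ν n hr (Nat.le_succ r) (by omega) hx)
    (missingMass_upper_tail ν n hr hn.le hτ.le hx)
    ((exists_large_missing_le ν n hτ).trans hlarge) fun y h1 h2 h3 h4 => ?_
  rw [Set.mem_ofPred_eq, not_lt] at h1 h2 h3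
  rw [Set.mem_ofPred_eq, upperBound_eq hr (by omega), ← weightedCount_truncWeight_eq ν n h4]
  refine (upper_of_typical hx
    (by exact_mod_cast Nat.choose_pos (by omega)) (by exact_mod_cast Nat.choose_pos (by omega))
    (expNumGe_pos ν n hr (by omega)).le
    (Nat.cast_nonneg _) h1 h2 (expMass_le ν n hr (by omega) τ) h3).trans ?_
  have h2r : (1 : ℝ) ≤ 2 ^ (r + 1) := one_le_pow₀ (by norm_num)
  have : τ ^ r / 3 * x ≤ τ ^ r * (2 ^ (r + 1) * x / 3) := by
    rw [div_mul_eq_mul_div, mul_div_assoc]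
    gcongr
    exact le_mul_of_one_le_left hx.le h2r
  linarith

end

/-! ### Transfer from the support to the full space -/

section

variable {S : Type*} {A : Set S} {n : ℕ}

theorem freq_coe (y : Fin n → A) (s : A) : freq (fun i => (y i : S)) s = freq y s := by
  classical
  simp only [freq_eq_card, Subtype.ext_iff]

theorem freq_coe_of_notMem (y : Fin n → A) {s : S} (hs : s ∉ A) :
    freq (fun i => (y i : S)) s = 0 := by
  classical
  rw [freq_eq_card, Finset.card_eq_zero, Finset.filter_eq_empty_iff]
  exact fun i _ h => hs (h ▸ (y i).2)

theorem ncard_freq_coe (y : Fin n → A) {p : ℕ → Prop} (hp : ¬ p 0) :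
    {s : S | p (freq (fun i => (y i : S)) s)}.ncard = {s : A | p (freq y s)}.ncard := by
  rw [← Set.ncard_image_of_injective _ Subtype.val_injective]
  congr 1
  ext s
  simp only [Set.mem_ofPred_eq, Set.mem_image, Subtype.exists, exists_and_right, exists_eq_right]
  constructor
  · intro h
    by_cases hs : s ∈ A
    · exact ⟨hs, by rwa [← freq_coe]⟩
    · rw [freq_coe_of_notMem y hs] at h
      exact absurd h hp
  · rintro ⟨hs, h⟩
    rwa [← freq_coe] at h

theorem numEq_coe (y : Fin n → A) {r : ℕ} (hr : 1 ≤ r) :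
    numEq (fun i => (y i : S)) r = numEq y r :=
  ncard_freq_coe y (p := fun k => k = r) (by omega)

theorem numGe_coe (y : Fin n → A) {r : ℕ} (hr : 1 ≤ r) :
    numGe (fun i => (y i : S)) r = numGe y r :=
  ncard_freq_coe y (p := fun k => r ≤ k) (by omega)

theorem lowerBound_coe (y : Fin n → A) {r : ℕ} (hr : 1 ≤ r) (x : ℝ) :
    lowerBound r x (fun i => (y i : S)) = lowerBound r x y := by
  simp only [lowerBound, thetaGT, numEq_coe y hr, numGe_coe y hr]

theorem upperBound_coe (y : Fin n → A) {r : ℕ} (hr : 1 ≤ r) (x : ℝ) :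
    upperBound r x (fun i => (y i : S)) = upperBound r x y := by
  simp only [upperBound, thetaGT, numEq_coe y hr, numGe_coe y hr]

end

theorem theta_nonneg {S : Type*} (P : PMF S) {n : ℕ} (r : ℕ) (y : Fin n → S) :
    0 ≤ theta r P y :=
  tsum_nonneg fun s => by positivity

theorem theta_le_one {S : Type*} (P : PMF S) {n r : ℕ} (hr : 1 ≤ r) (y : Fin n → S) :
    theta r P y ≤ 1 := by
  have hP : HasSum (fun s => (P s).toReal) 1 := by
    have := ENNReal.hasSum_toReal (f := P) P.tsum_coe_ne_top
    rwa [← ENNReal.tsum_toReal_eq fun s => P.apply_ne_top s, P.tsum_coe,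
      ENNReal.toReal_one] at this
  have hle : ∀ s, (P s).toReal ^ r * (if freq y s = 0 then 1 else 0) ≤ (P s).toReal := by
    intro s
    have h1 : (P s).toReal ≤ 1 := ENNReal.toReal_le_of_le_ofReal zero_le_one
      (by simpa using P.coe_le_one s)
    have h2 : (P s).toReal ^ r ≤ (P s).toReal :=
      pow_le_of_le_one ENNReal.toReal_nonneg h1 (by omega)
    split_ifs
    · simpa using h2
    · simp
  exact (Summable.tsum_le_tsum hle (Summable.of_nonneg_of_le (fun s => by positivity) hle
    hP.summable) hP.summable).trans hP.tsum_eq.le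

section

variable {S : Type*} [MeasurableSpace S] [MeasurableSingletonClass S] (P : PMF S)

/-- The law `P`, as a measure on its support. -/
noncomputable def supportMeasure : Measure P.support :=
  P.toMeasure.comap Subtype.val

theorem map_supportMeasure : (supportMeasure P).map Subtype.val = P.toMeasure := by
  rw [supportMeasure, (MeasurableEmbedding.subtype_coe P.support_countable.measurableSet).map_comap,
    Subtype.range_coe, PMF.restrict_toMeasure_support]

instance : IsProbabilityMeasure (supportMeasure P) := by
  constructor
  have h := congrArg (fun m => m Set.univ) (map_supportMeasure P)
  simpa [Measure.map_apply measurable_subtype_coe MeasurableSet.univ] using h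

theorem supportMeasure_real_singleton (s : P.support) :
    (supportMeasure P).real {s} = (P s).toReal := by
  rw [measureReal_def, supportMeasure,
    (MeasurableEmbedding.subtype_coe P.support_countable.measurableSet).comap_apply,
    Set.image_singleton, PMF.toMeasure_apply_singleton _ _ (.singleton _)]

theorem theta_coe {n r : ℕ} (hr : 1 ≤ r) (y : Fin n → P.support) :
    theta r P (fun i => (y i : S)) = weightedCount (truncWeight (supportMeasure P) r 1) {0} y := by
  unfold theta weightedCount
  rw [← tsum_subtype_eq_of_support_subset (s := P.support)]
  · refine tsum_congr fun s => ?_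
    rw [truncWeight_one, supportMeasure_real_singleton, freq_coe]
    by_cases h : freq y s = 0 <;> simp [h]
  · intro s hs
    rw [PMF.mem_support_iff]
    -- Symbols off the support contribute `0 ^ r`, which vanishes because `r ≥ 1`.
    intro h
    refine hs ?_
    simp only [h, ENNReal.toReal_zero, zero_pow (by omega : r ≠ 0), zero_mul]

/-- `G` need not be measurable. Its part made of samples from the support is countable, hence
measurable, and comparing laws there gives the inequality. -/
theorem pi_supportMeasure_le {Ω : Type*} [MeasurableSpace Ω] {μ : Measure Ω}
    [IsProbabilityMeasure μ] {n : ℕ} {X : Fin n → Ω → S} (hindep : iIndepFun X μ)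
    (hlaw : ∀ i, HasLaw (X i) P.toMeasure μ) (G : Set (Fin n → S)) :
    (Measure.pi fun _ : Fin n => supportMeasure P).real {y | (fun i => (y i : S)) ∈ G}
      ≤ μ.real {ω | (fun i => X i ω) ∈ G} := by
  have := P.support_countable.to_subtype
  set H : Set (Fin n → P.support) := {y | (fun i => (y i : S)) ∈ G}
  set e : (Fin n → P.support) → Fin n → S := fun y i => y i
  have he : Measurable e := by fun_prop
  have hm : MeasurableSet (e '' H) := ((Set.to_countable H).image e).measurableSet
  have hX : AEMeasurable (fun ω i => X i ω) μ :=
    aemeasurable_pi_lambda _ fun i => (hlaw i).aemeasurable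
  have hmap : μ.map (fun ω i => X i ω) = (Measure.pi fun _ : Fin n => supportMeasure P).map e := by
    rw [(iIndepFun_iff_map_fun_eq_pi_map fun i => (hlaw i).aemeasurable).1 hindep]
    simp_rw [(hlaw _).map_eq, ← map_supportMeasure P]
    exact (Measure.pi_map_pi fun _ => measurable_subtype_coe.aemeasurable).symm
  calc (Measure.pi fun _ : Fin n => supportMeasure P).real H
      ≤ (Measure.pi fun _ : Fin n => supportMeasure P).real (e ⁻¹' (e '' H)) :=
        measureReal_mono (Set.subset_preimage_image e H)
    _ = (μ.map (fun ω i => X i ω)).real (e '' H) := by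
        rw [hmap, map_measureReal_apply he hm]
    _ = μ.real ((fun ω i => X i ω) ⁻¹' (e '' H)) := by
        rw [measureReal_def, measureReal_def, Measure.map_apply_of_aemeasurable hX hm]
    _ ≤ μ.real {ω | (fun i => X i ω) ∈ G} := by
        refine measureReal_mono ?_
        rintro ω ⟨y, hy, hyω⟩
        have : e y ∈ G := hy
        rwa [hyω] at this

end

end MissingMass

theorem proposition2 {S : Type*} [MeasurableSpace S] [MeasurableSingletonClass S]
    (P : PMF S) {Ω : Type*} [MeasurableSpace Ω] (μ : Measure Ω) [IsProbabilityMeasure μ]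
    (n r : ℕ) (hr : 1 ≤ r) (hn : 2 * r < n)
    (X : Fin n → Ω → S) (hindep : iIndepFun X μ) (hlaw : ∀ i, HasLaw (X i) P.toMeasure μ)
    (x : ℝ) (hx : 0 < x) :
    1 - 6 * Real.exp (-x) ≤
        μ.real {ω | max 0 (MissingMass.lowerBound r x (fun i => X i ω)) ≤
          MissingMass.theta r P (fun i => X i ω)} ∧
      1 - 7 * Real.exp (-x) ≤
        μ.real {ω | MissingMass.theta r P (fun i => X i ω) ≤
          min (MissingMass.upperBound r x (fun i => X i ω)) 1} := by
  have := P.support_countable.to_subtype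
  have hexp := Real.exp_pos (-x)
  constructor
  · have h1 := MissingMass.lowerBound_confidence (MissingMass.supportMeasure P) hr hn hx
    have h2 := MissingMass.pi_supportMeasure_le P hindep hlaw
      {y | max 0 (MissingMass.lowerBound r x y) ≤ MissingMass.theta r P y}
    simp only [Set.mem_ofPred_eq, max_le_iff, MissingMass.theta_nonneg, true_and,
      MissingMass.lowerBound_coe _ hr, MissingMass.theta_coe P hr] at h2 ⊢
    linarith
  · have h1 := MissingMass.upperBound_confidence (MissingMass.supportMeasure P) hr hn hx
    have h2 := MissingMass.pi_supportMeasure_le P hindep hlaw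
      {y | MissingMass.theta r P y ≤ min (MissingMass.upperBound r x y) 1}
    simp only [Set.mem_ofPred_eq, le_min_iff, MissingMass.theta_le_one P hr, and_true,
      MissingMass.upperBound_coe _ hr, MissingMass.theta_coe P hr] at h2 ⊢
    linarith
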